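/- Let $K$ be a field, let $G$ be a finite simple graph with vertex set $\{v_1,\dots,v_n\}$, let $S=K[x_1,\dots,x_n]$, and let $I=I(G)\subseteq S$ be the edge ideal of $G$, generated by the monomials $x_ix_j$ with $\{v_i,v_j\}$ an edge of $G$. Let $p$ be the number of connected components of $G$ that are bipartite (isolated vertices included). Then for every integer $k\ge 1$, $$\operatorname{sdepth}(S/I^k)\ \ge\ p .$$ Here, for a finitely generated $\mathbb{Z}^n$-graded $S$-module $M$, a Stanley space of dimension $|Z|$ is a $K$-subspace $uK[Z]=\{uf : f\in K[Z]\}$ of $M$, with $u\in M$ a non-zero homogeneous element and $Z\subseteq\{x_1,\dots,x_n\}$, that is a free $K[Z]$-module; a Stanley decomposition of $M$ is a decomposition of $M$ as a finite direct sum of Stanley spaces (as a $K$-vector space); the Stanley depth of a decomposition is the minimum dimension of its Stanley spaces; and $\operatorname{sdepth}(M)$ is the maximum of the Stanley depths of all Stanley decompositions of $M$. -/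

import Mathlib

open MvPolynomial

noncomputable section

/-- The edge ideal of a graph `G` in the polynomial ring `K[x_v : v ∈ V]`, generated by the
monomials `x_v x_w` over the edges `{v, w}` of `G`. -/
def edgeIdeal {V : Type*} (K : Type*) [Field K] (G : SimpleGraph V) : Ideal (MvPolynomial V K) :=
  Ideal.span {f | ∃ v w : V, G.Adj v w ∧ f = X v * X w}

/-- The number of connected components of `G` which are bipartite graphs (an isolated vertex is
such a component). -/
def numBipartiteComponents {V : Type*} (G : SimpleGraph V) : ℕ :=
  Nat.card {c : G.ConnectedComponent // c.toSimpleGraph.IsBipartite}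

/-- The `ℤ^V`-grading of the quotient `S ⧸ J` of `S = K[x_v : v ∈ V]` (for a monomial ideal `J`):
the component of degree `a` is the image of that of `S`, where `x_v` has as its degree the
`v`-th unit vector. -/
def quotientGrading {V K : Type*} [Field K] (J : Ideal (MvPolynomial V K)) (a : V →₀ ℤ) :
    Submodule K (MvPolynomial V K ⧸ J) :=
  (weightedHomogeneousSubmodule K (fun v : V => Finsupp.single v (1 : ℤ)) a).map
    (Ideal.Quotient.mkₐ K J).toLinearMap

section StanleyDepth

variable {V K M : Type*} [Field K] [AddCommGroup M] [Module K M] [Module (MvPolynomial V K) M]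
  [IsScalarTower K (MvPolynomial V K) M]

/-- The `K`-subspace `u K[Z]` of `M`, generated by all `f • u` with `f ∈ K[Z]`. -/
def stanleySubspace (u : M) (Z : Finset V) : Submodule K M :=
  (Submodule.span (supported K (Z : Set V)) {u}).restrictScalars K

/-- A Stanley decomposition of a module `M` over `K[x_v : v ∈ V]` with grading `𝓜`: a finite
family of subspaces `u_i K[Z_i]` with `u_i` non-zero and homogeneous, each of them free as a
`K[Z_i]`-module, of which `M` is the direct sum as a `K`-vector space. -/
structure StanleyDecomposition (𝓜 : (V →₀ ℤ) → Submodule K M) where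
  /-- the number of Stanley spaces -/
  r : ℕ
  /-- the generators -/
  u : Fin r → M
  /-- the sets of variables -/
  Z : Fin r → Finset V
  homogeneous : ∀ i, ∃ a, u i ∈ 𝓜 a
  ne_zero : ∀ i, u i ≠ 0
  free : ∀ i, Module.Free (supported K (Z i : Set V))
    (Submodule.span (supported K (Z i : Set V)) {u i})
  isInternal : DirectSum.IsInternal fun i => stanleySubspace (K := K) (u i) (Z i)

/-- The Stanley depth of a Stanley decomposition: the least dimension `|Z_i|` of its Stanley
spaces (`⊤` for the empty decomposition of the zero module). -/
def StanleyDecomposition.sdepth {𝓜 : (V →₀ ℤ) → Submodule K M} (D : StanleyDecomposition 𝓜) :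
    WithBot ℕ∞ :=
  ⨅ i, ((D.Z i).card : WithBot ℕ∞)

/-- The Stanley depth of the graded module `M`: the largest Stanley depth of a Stanley
decomposition of `M` (it would be `⊥` if there were none). -/
def stanleyDepth (𝓜 : (V →₀ ℤ) → Submodule K M) : WithBot ℕ∞ :=
  ⨆ D : StanleyDecomposition 𝓜, D.sdepth

end StanleyDepth

end

/-! A monomial `x^a` lies in `I^k` exactly when the numbers `F c a` sum to at least `k`, where `F c
a` is the largest number, capped at `k`, of edges of the component `c` (with repetition) whose
product divides `x^a` (`exists_edges_iff_le_sum_matchingNumber`). So it suffices to partition all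
exponent vectors into finitely many cones of dimension at least `p` on which every `F c` is
constant: the cones outside `I^k` then give a Stanley decomposition (`le_stanleyDepth_of_cones`).

Each bipartite component supplies one free direction. By the weighted Kőnig theorem the uncapped
maximum is bounded by the weight of a vertex cover, and the cover can be taken to miss some vertex
of the component; raising the exponent there creates no larger matching (`exists_free_vertex`).

This direction depends on `a`, so it has to be selected coherently for the cones to be disjoint. The
label of `a` at `c` records `F c a` and a free vertex picked by `exists_stable_choice`, which makes
the label survive growth of that coordinate. Since components have disjoint vertex sets, the
selections do not interfere, and `exists_exponentCone_partition` turns the labels into cones. -/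

/-! ### Partitions of exponent vectors into cones -/

/-- The set of exponents of the monomials in `x^b K[Z]`. -/
def exponentCone {V : Type*} (b : V → ℕ) (Z : Finset V) : Set (V → ℕ) :=
  {a | b ≤ a ∧ ∀ u ∉ Z, a u = b u}

/-- Labels `L c` on exponent vectors which depend only on the coordinates in the fibre of `c`, cut
off at `k`, and which for `c ∈ P` are stable when a coordinate selected by the label grows: the
exponent vectors then split into finitely many cones with constant labels, each of dimension at
least `|P|`. -/
theorem exists_exponentCone_partition {V C Λ : Type*} [Finite V] (π : V → C) (P : Finset C) (k : ℕ)
    (L : C → (V → ℕ) → Λ) (s : C → Λ → V)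
    (hL : ∀ c a b, (∀ u, π u = c → min (a u) k = min (b u) k) → L c a = L c b)
    (hs : ∀ c ∈ P, ∀ a, π (s c (L c a)) = c)
    (hstable : ∀ c ∈ P, ∀ a t, a (s c (L c a)) ≤ t →
      L c (open Classical in Function.update a (s c (L c a)) t) = L c a) :
    ∃ T : Set ((V → ℕ) × Finset V), T.Finite ∧
      (∀ i ∈ T, P.card ≤ i.2.card) ∧
      (∀ a, ∃! i, i ∈ T ∧ a ∈ exponentCone i.1 i.2) ∧
      ∀ i ∈ T, ∀ a ∈ exponentCone i.1 i.2, ∀ c, L c a = L c i.1 := by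
  classical
  have := Fintype.ofFinite V
  let sp : (V → ℕ) → V → Prop := fun a u => π u ∈ P ∧ s (π u) (L (π u) a) = u
  -- The corner of the cone of `a`: a selected coordinate drops to the least value keeping its
  -- label, any other is cut off at `k`. The free directions `Z a` are the selected coordinates and
  -- those where the cutoff is reached.
  let ρ : (V → ℕ) → V → ℕ := fun a u =>
    if sp a u then sInf {t | L (π u) (Function.update a u t) = L (π u) a} else min (a u) k
  let Z : (V → ℕ) → Finset V := fun a => {u | sp a u ∨ k ≤ a u}
  have hρ1 : ∀ a u, sp a u → ρ a u = sInf {t | L (π u) (Function.update a u t) = L (π u) a} :=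
    fun a u h => if_pos h
  have hρ2 : ∀ a u, ¬ sp a u → ρ a u = min (a u) k := fun a u h => if_neg h
  have hZ : ∀ a u, u ∈ Z a ↔ sp a u ∨ k ≤ a u := fun a u => by simp [Z]
  have hρmem : ∀ a u, sp a u → L (π u) (Function.update a u (ρ a u)) = L (π u) a := by
    intro a u h
    rw [hρ1 a u h]
    exact Nat.sInf_mem (s := {t | L (π u) (Function.update a u t) = L (π u) a}) ⟨a u, by simp⟩
  have hρle : ∀ a, ρ a ≤ a := by
    intro a u
    by_cases h : sp a u
    · rw [hρ1 a u h]; exact Nat.sInf_le (by simp)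
    · rw [hρ2 a u h]; exact min_le_left _ _
  -- Labels see coordinates only up to `k`, so the corners lie in a finite box; this makes the
  -- family of cones finite.
  have hρk : ∀ a u, ρ a u ≤ k := by
    intro a u
    by_cases h : sp a u
    · rcases le_total (a u) k with h' | h'
      · exact (hρle a u).trans h'
      · rw [hρ1 a u h]
        refine Nat.sInf_le (hL _ _ _ fun w _ => ?_)
        rcases eq_or_ne w u with rfl | hw
        · simp [h']
        · simp [hw]
    · rw [hρ2 a u h]; exact min_le_right _ _
  have hself : ∀ a, a ∈ exponentCone (ρ a) (Z a) := by
    refine fun a => ⟨hρle a, fun u hu => ?_⟩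
    rw [hZ, not_or] at hu
    rw [hρ2 a u hu.1]; omega
  -- within the cone of `a`, a non-selected coordinate agrees with that of `a` up to truncation
  have hcoord : ∀ a, ∀ a' ∈ exponentCone (ρ a) (Z a), ∀ u, ¬ sp a u →
      min (a' u) k = min (a u) k := by
    intro a a' ha' u hu
    have h1 := ha'.1 u
    rw [hρ2 a u hu] at h1
    by_cases h : u ∈ Z a
    · have := ((hZ a u).1 h).resolve_left hu
      rw [min_eq_right this] at h1 ⊢
      exact min_eq_right h1
    · have h2 := ha'.2 u h
      rw [hρ2 a u hu] at h2
      omega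
  -- A fibre has at most one selected coordinate; once that one is overwritten, `a` and `a'` agree
  -- on the fibre up to the cutoff.
  have hupd : ∀ a, ∀ a' ∈ exponentCone (ρ a) (Z a), ∀ u, sp a u → ∀ t,
      L (π u) (Function.update a' u t) = L (π u) (Function.update a u t) := by
    intro a a' ha' u hu t
    refine hL _ _ _ fun w hw => ?_
    rcases eq_or_ne w u with rfl | hwu
    · simp
    · simp only [Function.update_of_ne hwu]
      refine hcoord a a' ha' w fun h => hwu ?_
      rw [← h.2, hw, hu.2]
  have hlabel : ∀ a, ∀ a' ∈ exponentCone (ρ a) (Z a), ∀ c, L c a' = L c a := by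
    intro a a' ha' c
    by_cases h : ∃ u, sp a u ∧ π u = c
    · obtain ⟨u, hu, rfl⟩ := h
      have h1 := hρmem a u hu
      -- Stability is applied from the corner value upwards, not from `a u`, because `a' u` may be
      -- smaller than `a u`.
      have h2 := hstable (π u) hu.1 (Function.update a u (ρ a u)) (a' u)
      rw [h1, hu.2] at h2
      have h3 := h2 (by simpa using ha'.1 u)
      rw [Function.update_idem] at h3
      rw [← h3, ← hupd a a' ha' u hu, Function.update_eq_self]
    · push Not at h
      exact hL _ _ _ fun u hu => hcoord a a' ha' u fun h' => h u h' hu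
  have hsp : ∀ a, ∀ a' ∈ exponentCone (ρ a) (Z a), ∀ u, sp a' u ↔ sp a u := by
    intro a a' ha' u
    simp only [sp, hlabel a a' ha']
  -- Every point of a cone generates that same cone, so two cones that meet coincide.
  have hkey : ∀ a, ∀ a' ∈ exponentCone (ρ a) (Z a), ρ a' = ρ a ∧ Z a' = Z a := by
    intro a a' ha'
    constructor
    · funext u
      by_cases h : sp a u
      · rw [hρ1 a u h, hρ1 a' u ((hsp a a' ha' u).2 h), hlabel a a' ha']
        simp only [hupd a a' ha' u h]
      · rw [hρ2 a u h, hρ2 a' u (mt (hsp a a' ha' u).1 h), hcoord a a' ha' u h]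
    · ext u
      rw [hZ, hZ, hsp a a' ha' u]
      by_cases h : sp a u
      · simp [h]
      · have := hcoord a a' ha' u h
        simp only [h, false_or]
        omega
  have hcard : ∀ a, P.card ≤ (Z a).card := by
    intro a
    refine Finset.card_le_card_of_injOn (fun c => s c (L c a)) (fun c hc => ?_) ?_
    · rw [Finset.mem_coe, hZ]
      left
      have := hs c hc a
      simp only [sp, this, and_true]
      exact hc
    · intro c hc c' hc' h
      have h1 := hs c hc a
      have h2 := hs c' hc' a
      simp only at h
      rw [← h1, h, h2]
  refine ⟨Set.range fun a => (ρ a, Z a), ?_, ?_, ?_, ?_⟩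
  · refine Set.Finite.subset ((Set.finite_Iic (fun _ : V => k)).prod Set.finite_univ) ?_
    rintro _ ⟨a, rfl⟩
    exact ⟨fun u => hρk a u, trivial⟩
  · rintro _ ⟨a, rfl⟩
    exact hcard a
  · refine fun a => ⟨_, ⟨⟨a, rfl⟩, hself a⟩, ?_⟩
    rintro _ ⟨⟨a', rfl⟩, h⟩
    obtain ⟨h1, h2⟩ := hkey a' a h
    simp only [h1, h2]
  · rintro _ ⟨a, rfl⟩ a' ha' c
    rw [hlabel a a' ha' c, hlabel a (ρ a) ⟨le_rfl, fun _ _ => rfl⟩ c]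

/-! ### Stanley decompositions from cones of monomials -/

/-- Monomials outside a monomial ideal are linearly independent modulo the ideal. -/
theorem linearIndependent_mk_monomial {V K : Type*} [Field K] {J : Ideal (MvPolynomial V K)}
    {X : Set (V →₀ ℕ)} (hX : ∀ f, f ∈ J ↔ ∀ m ∈ f.support, m ∉ X) :
    LinearIndependent K fun x : X => (Ideal.Quotient.mk J (monomial x.1 1)) := by
  rw [linearIndependent_iff]
  intro l hl
  have h1 : Finsupp.linearCombination K (fun x : X => Ideal.Quotient.mk J (monomial x.1 1)) l =
      Ideal.Quotient.mk J (Finsupp.linearCombination K (fun x : X => monomial x.1 (1 : K)) l) := by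
    rw [Finsupp.linearCombination_apply, Finsupp.linearCombination_apply, Finsupp.sum, Finsupp.sum,
      map_sum]
    rfl
  rw [h1, Ideal.Quotient.eq_zero_iff_mem, hX] at hl
  ext x
  by_contra hx
  refine hl x.1 ?_ x.2
  have : coeff x.1 (Finsupp.linearCombination K (fun x : X => monomial x.1 (1 : K)) l) = l x := by
    classical
    rw [Finsupp.linearCombination_apply, Finsupp.sum, coeff_sum]
    simp only [coeff_smul, coeff_monomial, smul_eq_mul, mul_ite, mul_one, mul_zero,
      Subtype.coe_inj]
    rw [Finset.sum_ite_eq']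
    simp +contextual [eq_comm]
  rw [mem_support_iff, this]
  exact hx

theorem span_mk_monomial_eq_top {V K : Type*} [Field K] {J : Ideal (MvPolynomial V K)}
    {X : Set (V →₀ ℕ)} (hX : ∀ f, f ∈ J ↔ ∀ m ∈ f.support, m ∉ X) :
    Submodule.span K (Set.range fun x : X => (Ideal.Quotient.mk J (monomial x.1 1))) = ⊤ := by
  rw [eq_top_iff]
  rintro y -
  obtain ⟨f, rfl⟩ := Ideal.Quotient.mk_surjective y
  rw [f.as_sum, map_sum]
  refine Submodule.sum_mem _ fun m _ => ?_
  by_cases hm : m ∈ X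
  · have : Ideal.Quotient.mk J (monomial m (coeff m f)) =
        coeff m f • Ideal.Quotient.mk J (monomial m 1) := by
      rw [← mul_one (coeff m f), ← smul_eq_mul, ← smul_monomial]
      simp only [smul_eq_mul, mul_one]
      rfl
    rw [this]
    exact Submodule.smul_mem _ _ (Submodule.subset_span ⟨⟨m, hm⟩, rfl⟩)
  · rw [Ideal.Quotient.eq_zero_iff_mem.2]
    · exact Submodule.zero_mem _
    · rw [hX]
      intro m' hm'
      have := support_monomial_subset hm'
      rw [Finset.mem_singleton] at this
      exact this ▸ hm

theorem monomial_mem_supported_of_support_subset {V K : Type*} [Field K] {Z : Finset V}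
    {z : V →₀ ℕ} (hz : z.support ⊆ Z) (r : K) : monomial z r ∈ supported K (Z : Set V) := by
  rw [mem_supported]
  intro v hv
  obtain ⟨m, hm, hvm⟩ := (mem_vars_iff_mem_support v).1 hv
  have := support_monomial_subset hm
  rw [Finset.mem_singleton] at this
  exact hz (this ▸ hvm)

theorem support_subset_of_mem_supported {V K : Type*} [Field K] {Z : Finset V}
    {f : MvPolynomial V K} (hf : f ∈ supported K (Z : Set V)) {m : V →₀ ℕ} (hm : m ∈ f.support) :
    m.support ⊆ Z := by
  rw [mem_supported] at hf
  exact fun v hv => hf ((mem_vars_iff_mem_support v).2 ⟨m, hm, hv⟩)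

theorem add_mem_exponentCone {V : Type*} {Z : Finset V} {b z : V →₀ ℕ} (hz : z.support ⊆ Z) :
    ⇑(z + b) ∈ exponentCone b Z := by
  refine ⟨fun u => by simp, fun u hu => ?_⟩
  have : z u = 0 := Finsupp.notMem_support_iff.1 fun h => hu (hz h)
  simp [this]

/-- The Stanley space of a monomial is spanned by the monomials in its cone. -/
theorem stanleySubspace_mk_monomial {V K : Type*} [Field K] {J : Ideal (MvPolynomial V K)}
    {X : Set (V →₀ ℕ)} {b : V →₀ ℕ} {Z : Finset V}
    (hbX : ∀ a : V →₀ ℕ, ⇑a ∈ exponentCone b Z → a ∈ X) :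
    stanleySubspace (K := K) (Ideal.Quotient.mk J (monomial b 1)) Z =
      Submodule.span K ((fun x : X => Ideal.Quotient.mk J (monomial x.1 1)) ''
        {x | ⇑x.1 ∈ exponentCone b Z}) := by
  apply le_antisymm
  · intro y hy
    obtain ⟨⟨f, hf⟩, rfl⟩ := Submodule.mem_span_singleton.1 hy
    have h1 : (⟨f, hf⟩ : supported K (Z : Set V)) • Ideal.Quotient.mk J (monomial b (1 : K)) =
        Ideal.Quotient.mk J (f * monomial b 1) := rfl
    rw [h1]
    nth_rw 1 [f.as_sum]
    rw [Finset.sum_mul, map_sum]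
    refine Submodule.sum_mem _ fun m hm => ?_
    have h2 : Ideal.Quotient.mk J (monomial m (coeff m f) * monomial b 1) =
        coeff m f • Ideal.Quotient.mk J (monomial (m + b) 1) := by
      rw [monomial_mul, mul_one]
      nth_rw 1 [← mul_one (coeff m f)]
      rw [← smul_eq_mul, ← smul_monomial]
      rfl
    rw [h2]
    have h3 := add_mem_exponentCone (b := b) (support_subset_of_mem_supported hf hm)
    exact Submodule.smul_mem _ _ (Submodule.subset_span ⟨⟨m + b, hbX _ h3⟩, h3, rfl⟩)
  · rw [Submodule.span_le]
    rintro _ ⟨⟨a, ha⟩, hc, rfl⟩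
    refine Submodule.mem_span_singleton.2 ⟨⟨monomial (a - b) 1,
      monomial_mem_supported_of_support_subset ?_ 1⟩, ?_⟩
    · intro u hu
      by_contra h
      have : a u = b u := hc.2 u h
      simp at hu
      omega
    · change Ideal.Quotient.mk J (monomial (a - b) 1 * monomial b 1) = _
      rw [monomial_mul, mul_one, tsub_add_cancel_of_le]
      exact hc.1

theorem free_span_singleton_of_smul_eq_zero {R M : Type*} [Ring R] [AddCommGroup M] [Module R M]
    (u : M) (hu : ∀ f : R, f • u = 0 → f = 0) : Module.Free R (Submodule.span R {u}) := by
  rw [← LinearMap.range_toSpanSingleton]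
  exact Module.Free.of_equiv (LinearEquiv.ofInjective (LinearMap.toSpanSingleton R M u)
    ((injective_iff_map_eq_zero _).2 fun f hf => hu f hf))

/-- Multiplication by `x^b` shifts exponents injectively, and the shifted exponents stay in the
cone, hence outside `J`. This yields freeness of the Stanley spaces. -/
theorem eq_zero_of_mul_monomial_mem {V K : Type*} [Field K] {J : Ideal (MvPolynomial V K)}
    {X : Set (V →₀ ℕ)} (hX : ∀ f, f ∈ J ↔ ∀ m ∈ f.support, m ∉ X) {b : V →₀ ℕ} {Z : Finset V}
    (hbX : ∀ a : V →₀ ℕ, ⇑a ∈ exponentCone b Z → a ∈ X) {f : MvPolynomial V K}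
    (hf : f ∈ supported K (Z : Set V)) (h : f * monomial b 1 ∈ J) : f = 0 := by
  rw [hX] at h
  ext m
  rw [coeff_zero]
  by_contra hm
  refine h (m + b) ?_ (hbX _ (add_mem_exponentCone
    (support_subset_of_mem_supported hf (mem_support_iff.2 hm))))
  rw [mem_support_iff, coeff_mul_monomial, mul_one]
  exact hm

theorem mk_monomial_mem_quotientGrading {V K : Type*} [Field K] (J : Ideal (MvPolynomial V K))
    (b : V →₀ ℕ) :
    ∃ a, Ideal.Quotient.mk J (monomial b (1 : K)) ∈ quotientGrading J a :=
  ⟨_, monomial b 1, isWeightedHomogeneous_monomial _ b 1 rfl, rfl⟩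

/-- A partition of the monomials outside a monomial ideal `J` into finitely many cones of dimension
at least `n` shows that the Stanley depth of `S ⧸ J` is at least `n`. -/
theorem le_stanleyDepth_of_cones {V K : Type*} [Field K] {J : Ideal (MvPolynomial V K)}
    {X : Set (V →₀ ℕ)} (hX : ∀ f, f ∈ J ↔ ∀ m ∈ f.support, m ∉ X) {ι : Type*} [Finite ι]
    (b : ι → V →₀ ℕ) (Z : ι → Finset V) (n : ℕ) (hn : ∀ i, n ≤ (Z i).card)
    (hbX : ∀ i, ∀ a : V →₀ ℕ, ⇑a ∈ exponentCone (b i) (Z i) → a ∈ X)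
    (hpart : ∀ a ∈ X, ∃! i, ⇑a ∈ exponentCone (b i) (Z i)) :
    (n : WithBot ℕ∞) ≤ stanleyDepth (quotientGrading J) := by
  obtain ⟨r, ⟨e⟩⟩ := Finite.exists_equiv_fin ι
  have hself : ∀ i, ⇑(b i) ∈ exponentCone (b i) (Z i) := fun i => ⟨le_rfl, fun _ _ => rfl⟩
  let D : StanleyDecomposition (quotientGrading J) :=
    { r := r
      u := fun i => Ideal.Quotient.mk J (monomial (b (e.symm i)) 1)
      Z := fun i => Z (e.symm i)
      homogeneous := fun i => mk_monomial_mem_quotientGrading J _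
      ne_zero := fun i => (linearIndependent_mk_monomial hX).ne_zero
        ⟨b (e.symm i), hbX _ _ (hself _)⟩
      free := fun i => free_span_singleton_of_smul_eq_zero _ fun f hf => Subtype.ext
        (eq_zero_of_mul_monomial_mem hX (hbX _) f.2 (Ideal.Quotient.eq_zero_iff_mem.1 hf))
      isInternal := by
        -- The monomials outside `J` form a basis of the quotient, and the Stanley spaces are
        -- spanned by the parts into which the cones split it.
        simp_rw [stanleySubspace_mk_monomial (hbX _)]
        apply DirectSum.isInternal_submodule_of_iSupIndep_of_iSup_eq_top
        · intro i
          simp_rw [← Submodule.span_iUnion, ← Set.image_iUnion]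
          refine (linearIndependent_mk_monomial hX).disjoint_span_image ?_
          rw [Set.disjoint_left]
          intro x hx hx'
          simp only [Set.mem_iUnion] at hx'
          obtain ⟨j, hji, hj⟩ := hx'
          exact hji (e.symm.injective ((hpart x.1 x.2).unique hj hx))
        · rw [← Submodule.span_iUnion, ← Set.image_iUnion, ← span_mk_monomial_eq_top hX,
            ← Set.image_univ]
          congr 2
          rw [Set.eq_univ_iff_forall]
          intro x
          obtain ⟨i, hi, -⟩ := hpart x.1 x.2
          exact Set.mem_iUnion.2 ⟨e i, by simpa using hi⟩ }
  refine le_iSup_of_le D (le_iInf fun i => ?_)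
  have := hn (e.symm i)
  exact_mod_cast this

/-! ### The weighted Kőnig theorem -/

theorem card_filter_eq_sigma_fst {γ : Type*} [Fintype γ] [DecidableEq γ] (c : γ → ℕ) (v : γ) :
    ({x : Σ v : γ, Fin (c v) | v = x.1} : Finset _).card = c v := by
  have : ({x : Σ v : γ, Fin (c v) | v = x.1} : Finset _) =
      ({v} : Finset γ).sigma fun _ => Finset.univ := by
    ext x; simp [eq_comm]
  rw [this]; simp

/-- The weighted form of Kőnig's theorem: in a bipartite graph with capacities on the vertices there
is a multiset of edges within the capacities which is at least as large as the weight of the vertex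
cover consisting of the complement of some `X` and of the neighbours of `X`. -/
theorem exists_capacitated_matching_and_cover {α β : Type*} [Fintype α] [Fintype β] [DecidableEq α]
    [DecidableEq β] (r : α → β → Prop) (a : α → ℕ) (b : β → ℕ) :
    ∃ (X : Finset α) (N : Finset β) (s : Multiset (α × β)), (∀ w, w ∈ N ↔ ∃ v ∈ X, r v w) ∧
      (∀ p ∈ s, r p.1 p.2) ∧ (∀ v, (s.map Prod.fst).count v ≤ a v) ∧
      (∀ w, (s.map Prod.snd).count w ≤ b w) ∧ ∑ v ∈ Xᶜ, a v + ∑ w ∈ N, b w ≤ s.card := by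
  classical
  let N : Finset α → Finset β := fun X => {w | ∃ v ∈ X, r v w}
  -- `X` has the largest deficiency `d`. Hall's theorem applies after replacing each vertex by as
  -- many copies as its capacity and adding `d` dummy partners adjacent to everything; at most `d`
  -- copies are then matched to dummies.
  obtain ⟨X, -, hX⟩ := Finset.exists_max_image (Finset.univ : Finset (Finset α))
    (fun X => (∑ v ∈ X, (a v : ℤ)) - ∑ w ∈ N X, (b w : ℤ)) ⟨∅, Finset.mem_univ _⟩
  have h0 := hX ∅ (Finset.mem_univ _)
  have hN0 : N ∅ = ∅ := by simp [N]
  rw [hN0, Finset.sum_empty, Finset.sum_empty, sub_zero] at h0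
  obtain ⟨d, hd⟩ : ∃ d, ∑ v ∈ X, a v = ∑ w ∈ N X, b w + d := by
    apply Nat.exists_eq_add_of_le
    zify
    linarith
  have hdef : ∀ Y : Finset α, ∑ v ∈ Y, a v ≤ ∑ w ∈ N Y, b w + d := by
    intro Y
    have h1 := hX Y (Finset.mem_univ _)
    zify at hd ⊢
    linarith
  let t : (Σ v : α, Fin (a v)) → Finset ((Σ w : β, Fin (b w)) ⊕ Fin d) :=
    fun x => (Finset.sigma ({w | r x.1 w} : Finset β) fun _ => Finset.univ).disjSum Finset.univ
  obtain ⟨f, hf, hft⟩ := (Finset.all_card_le_biUnion_card_iff_exists_injective t).1 (by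
    intro s
    rcases s.eq_empty_or_nonempty with rfl | ⟨x₀, hx₀⟩
    · simp
    have h1 : s.card ≤ ∑ v ∈ s.image Sigma.fst, a v := by
      have : s ⊆ (s.image Sigma.fst).sigma fun _ => Finset.univ := fun x hx => by
        simpa using ⟨x.2, hx⟩
      simpa using Finset.card_le_card this
    have h2 : ((N (s.image Sigma.fst)).sigma fun _ => Finset.univ).disjSum Finset.univ ⊆
        s.biUnion t := by
      rintro (y | y) hy
      · simp only [Finset.inl_mem_disjSum, Finset.mem_sigma, Finset.mem_univ, and_true, N,
          Finset.mem_filter, true_and, Finset.mem_image] at hy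
        obtain ⟨_, ⟨x, hx, rfl⟩, hr⟩ := hy
        exact Finset.mem_biUnion.2 ⟨x, hx, by simpa [t] using hr⟩
      · exact Finset.mem_biUnion.2 ⟨x₀, hx₀, by simp [t]⟩
    have h3 := Finset.card_le_card h2
    simp only [Finset.card_disjSum, Finset.card_sigma, Finset.card_univ, Fintype.card_fin] at h3
    exact (h1.trans (hdef _)).trans h3)
  let T : Finset ((Σ v : α, Fin (a v)) × (Σ w : β, Fin (b w))) := {p | f p.1 = Sum.inl p.2}
  have hT : ∀ p, p ∈ T ↔ f p.1 = Sum.inl p.2 := fun p => by simp [T]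
  refine ⟨X, N X, T.val.map fun p => (p.1.1, p.2.1), fun w => by simp [N], ?_, ?_, ?_, ?_⟩
  · intro p hp
    obtain ⟨q, hq, rfl⟩ := Multiset.mem_map.1 hp
    have h1 := hft q.1
    rw [(hT q).1 hq] at h1
    simpa [t] using h1
  · intro v
    rw [Multiset.map_map, Multiset.count_map]
    refine (Finset.card_le_card_of_injOn (s := T.filter fun p => v = p.1.1) Prod.fst ?_ ?_).trans_eq
      (card_filter_eq_sigma_fst a v)
    · intro p hp
      simpa using (Finset.mem_filter.1 hp).2
    · intro p hp q hq h
      have h1 := (hT p).1 (Finset.mem_filter.1 hp).1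
      have h2 := (hT q).1 (Finset.mem_filter.1 hq).1
      rw [h, h2] at h1
      exact Prod.ext h (Sum.inl_injective h1).symm
  · intro w
    rw [Multiset.map_map, Multiset.count_map]
    refine (Finset.card_le_card_of_injOn (s := T.filter fun p => w = p.2.1) Prod.snd ?_ ?_).trans_eq
      (card_filter_eq_sigma_fst b w)
    · intro p hp
      simpa using (Finset.mem_filter.1 hp).2
    · intro p hp q hq h
      have h1 := (hT p).1 (Finset.mem_filter.1 hp).1
      have h2 := (hT q).1 (Finset.mem_filter.1 hq).1
      rw [h, ← h2] at h1
      exact Prod.ext (hf h1) h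
  · rw [Multiset.card_map]
    change _ ≤ T.card
    have h1 : (Finset.univ : Finset (Σ v : α, Fin (a v))).image f ⊆
        (T.image Prod.snd).disjSum Finset.univ := by
      intro y hy
      obtain ⟨x, -, rfl⟩ := Finset.mem_image.1 hy
      rcases h : f x with z | z
      · simpa [T] using ⟨_, _, h⟩
      · simp
    have h2 := Finset.card_le_card h1
    rw [Finset.card_image_of_injective _ hf, Finset.card_disjSum] at h2
    have h3 : (T.image Prod.snd).card ≤ T.card := Finset.card_image_le
    simp only [Finset.card_univ, Fintype.card_sigma, Fintype.card_fin] at h2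
    have h4 := Finset.sum_add_sum_compl X a
    omega

/-! ### Powers of the edge ideal and matchings in components -/

noncomputable section

theorem Multiset.exists_le_card_eq {α : Type*} (s : Multiset α) {n : ℕ} (h : n ≤ s.card) :
    ∃ t ≤ s, t.card = n := by
  induction s using Quotient.inductionOn with
  | _ l =>
    exact ⟨(l.take n : List α), Multiset.coe_le.2 (List.take_sublist n l).subperm, by simpa using h⟩

/-- The exponent vector of the product of the monomials `x_v x_w` over the pairs `(v, w)` in `s`. -/
def edgeExponent {V : Type*} (s : Multiset (V × V)) : V →₀ ℕ :=
  (s.map fun p => Finsupp.single p.1 1 + Finsupp.single p.2 1).sum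

theorem edgeExponent_zero {V : Type*} : edgeExponent (0 : Multiset (V × V)) = 0 := rfl

theorem edgeExponent_add {V : Type*} (s t : Multiset (V × V)) :
    edgeExponent (s + t) = edgeExponent s + edgeExponent t := by
  simp [edgeExponent]

theorem edgeExponent_cons {V : Type*} (p : V × V) (s : Multiset (V × V)) :
    edgeExponent (p ::ₘ s) = Finsupp.single p.1 1 + Finsupp.single p.2 1 + edgeExponent s := by
  simp [edgeExponent]

theorem edgeExponent_sum {V ι : Type*} (T : Finset ι) (s : ι → Multiset (V × V)) :
    edgeExponent (∑ i ∈ T, s i) = ∑ i ∈ T, edgeExponent (s i) :=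
  map_sum (⟨⟨edgeExponent, edgeExponent_zero⟩, edgeExponent_add⟩ : Multiset (V × V) →+ (V →₀ ℕ)) s T

theorem edgeExponent_mono {V : Type*} {s t : Multiset (V × V)} (h : s ≤ t) :
    edgeExponent s ≤ edgeExponent t := by
  obtain ⟨r, rfl⟩ := Multiset.le_iff_exists_add.1 h
  rw [edgeExponent_add]
  exact le_self_add

theorem edgeExponent_apply {V : Type*} [DecidableEq V] (s : Multiset (V × V)) (u : V) :
    edgeExponent s u = (s.map Prod.fst).count u + (s.map Prod.snd).count u := by
  induction s using Multiset.induction with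
  | empty => rfl
  | cons p s ih =>
    simp only [edgeExponent_cons, Finsupp.add_apply, ih, Multiset.map_cons, Multiset.count_cons,
      Finsupp.single_apply, eq_comm (a := u)]
    ring

theorem mem_edgeIdeal_pow {V K : Type*} [Field K] (G : SimpleGraph V) (k : ℕ)
    (f : MvPolynomial V K) : f ∈ edgeIdeal K G ^ k ↔ ∀ m ∈ f.support,
      ∃ s : Multiset (V × V), s.card = k ∧ (∀ p ∈ s, G.Adj p.1 p.2) ∧ edgeExponent s ≤ m := by
  have key : edgeIdeal K G ^ k = Ideal.span ((fun m => monomial m (1 : K)) ''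
      {m | ∃ s : Multiset (V × V), s.card = k ∧ (∀ p ∈ s, G.Adj p.1 p.2) ∧ edgeExponent s = m}) := by
    induction k with
    | zero =>
      rw [pow_zero, eq_comm, Ideal.one_eq_top, Ideal.eq_top_iff_one]
      exact Ideal.subset_span ⟨0, ⟨0, rfl, by simp, rfl⟩, rfl⟩
    | succ k ih =>
      rw [pow_succ, ih, edgeIdeal, Ideal.span_mul_span']
      congr 1
      ext g
      constructor
      · rintro ⟨_, ⟨_, ⟨s, hs, hs', rfl⟩, rfl⟩, _, ⟨v, w, hvw, rfl⟩, rfl⟩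
        refine ⟨_, ⟨(v, w) ::ₘ s, by simpa using hs, ?_, rfl⟩, ?_⟩
        · intro p hp
          rcases Multiset.mem_cons.1 hp with rfl | hp
          · exact hvw
          · exact hs' p hp
        · simp only [edgeExponent_cons, X, monomial_mul, mul_one]
          rw [add_comm]
      · rintro ⟨_, ⟨s, hs, hs', rfl⟩, rfl⟩
        obtain ⟨p, t, rfl⟩ : ∃ p t, s = p ::ₘ t := by
          obtain ⟨p, hp⟩ := Multiset.card_pos_iff_exists_mem.1 (hs.symm ▸ Nat.succ_pos k : 0 < s.card)
          exact ⟨p, Multiset.exists_cons_of_mem hp⟩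
        refine ⟨_, ⟨_, ⟨t, by simpa using hs, fun q hq => hs' q (Multiset.mem_cons_of_mem hq), rfl⟩,
          rfl⟩, _, ⟨p.1, p.2, hs' p (Multiset.mem_cons_self _ _), rfl⟩, ?_⟩
        simp only [edgeExponent_cons, X, monomial_mul, mul_one]
        rw [add_comm]
  rw [key, mem_ideal_span_monomial_image]
  refine forall₂_congr fun m _ => ⟨?_, ?_⟩
  · rintro ⟨_, ⟨s, h1, h2, rfl⟩, h3⟩
    exact ⟨s, h1, h2, h3⟩
  · rintro ⟨s, h1, h2, h3⟩
    exact ⟨_, ⟨s, h1, h2, rfl⟩, h3⟩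

/-- The component `c` of `G` has a multiset of `j` edges whose product divides `x^a`. -/
def HasMatching {V : Type*} (G : SimpleGraph V) (c : G.ConnectedComponent) (j : ℕ) (a : V → ℕ) :
    Prop :=
  ∃ s : Multiset (V × V), s.card = j ∧
    (∀ p ∈ s, G.Adj p.1 p.2 ∧ G.connectedComponentMk p.1 = c) ∧ ∀ u, edgeExponent s u ≤ a u

theorem HasMatching.zero {V : Type*} (G : SimpleGraph V) (c : G.ConnectedComponent) (a : V → ℕ) :
    HasMatching G c 0 a :=
  ⟨0, rfl, by simp, fun u => by simp [edgeExponent_zero]⟩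

theorem HasMatching.of_le {V : Type*} {G : SimpleGraph V} {c : G.ConnectedComponent} {i j : ℕ}
    {a : V → ℕ} (h : HasMatching G c j a) (hij : i ≤ j) : HasMatching G c i a := by
  obtain ⟨s, rfl, h2, h3⟩ := h
  obtain ⟨t, ht, rfl⟩ := s.exists_le_card_eq hij
  exact ⟨t, rfl, fun p hp => h2 p (Multiset.mem_of_le ht hp),
    fun u => (edgeExponent_mono ht u).trans (h3 u)⟩

theorem edgeExponent_apply_eq_zero {V : Type*} {G : SimpleGraph V} {c : G.ConnectedComponent}
    {s : Multiset (V × V)} (hs : ∀ p ∈ s, G.Adj p.1 p.2 ∧ G.connectedComponentMk p.1 = c) {u : V}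
    (hu : G.connectedComponentMk u ≠ c) : edgeExponent s u = 0 := by
  classical
  rw [edgeExponent_apply, Nat.add_eq_zero_iff, Multiset.count_eq_zero, Multiset.count_eq_zero]
  constructor
  · intro h
    obtain ⟨p, hp, rfl⟩ := Multiset.mem_map.1 h
    exact hu (hs p hp).2
  · intro h
    obtain ⟨p, hp, rfl⟩ := Multiset.mem_map.1 h
    rw [← SimpleGraph.ConnectedComponent.connectedComponentMk_eq_of_adj (hs p hp).1] at hu
    exact hu (hs p hp).2

theorem edgeExponent_apply_le_card {V : Type*} {s : Multiset (V × V)} (hs : ∀ p ∈ s, p.1 ≠ p.2)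
    (u : V) : edgeExponent s u ≤ s.card := by
  classical
  induction s using Multiset.induction with
  | empty => simp [edgeExponent_zero]
  | cons p s ih =>
    have h1 := ih fun q hq => hs q (Multiset.mem_cons_of_mem hq)
    have h2 := hs p (Multiset.mem_cons_self _ _)
    simp only [edgeExponent_cons, Finsupp.add_apply, Finsupp.single_apply, Multiset.card_cons]
    split_ifs with h3 h4
    · exact absurd (h3.trans h4.symm) h2
    all_goals omega

/-- Edges have distinct ends, so at most `k` edges use each vertex at most `k` times: only exponents
in the component, cut off at `k`, matter. -/
theorem HasMatching.mono {V : Type*} {G : SimpleGraph V} {c : G.ConnectedComponent} {j k : ℕ}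
    {a b : V → ℕ} (h : HasMatching G c j a) (hj : j ≤ k)
    (hab : ∀ u, G.connectedComponentMk u = c → min (a u) k ≤ b u) : HasMatching G c j b := by
  obtain ⟨s, rfl, h2, h3⟩ := h
  refine ⟨s, rfl, h2, fun u => ?_⟩
  by_cases hu : G.connectedComponentMk u = c
  · exact (le_min (h3 u) ((edgeExponent_apply_le_card (fun p hp => (h2 p hp).1.ne) u).trans hj)).trans
      (hab u hu)
  · rw [edgeExponent_apply_eq_zero h2 hu]
    exact Nat.zero_le _

/-- In a bipartite component some vertex is such that raising its exponent creates no larger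
matching. -/
theorem exists_free_vertex {V : Type*} [Finite V] {G : SimpleGraph V} {c : G.ConnectedComponent}
    (hc : c.toSimpleGraph.IsBipartite) (a : V → ℕ) :
    ∃ v, G.connectedComponentMk v = c ∧ ∀ a' j, (∀ u ≠ v, a' u ≤ a u) →
      HasMatching G c j a' → HasMatching G c j a := by
  classical
  have := Fintype.ofFinite V
  obtain ⟨φ⟩ := hc
  obtain ⟨v₀, hv₀⟩ := c.nonempty_supp
  -- `v₀` is put on the `B` side so that a vertex stays uncovered even if `X` is empty: then `N` is
  -- empty too and the cover is just `A`.
  let A := {v : V // ∃ h : v ∈ c.supp, φ ⟨v, h⟩ ≠ φ ⟨v₀, hv₀⟩}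
  let B := {v : V // ∃ h : v ∈ c.supp, φ ⟨v, h⟩ = φ ⟨v₀, hv₀⟩}
  obtain ⟨X, N, s, hN, hr, ha, hb, hcard⟩ := exists_capacitated_matching_and_cover
    (fun (v : A) (w : B) => G.Adj v.1 w.1) (fun v => a v.1) (fun w => a w.1)
  let cov : Finset V := Xᶜ.map (Function.Embedding.subtype _) ∪ N.map (Function.Embedding.subtype _)
  have hcov : ∀ v, v ∈ cov ↔ (∃ h, (⟨v, h⟩ : A) ∉ X) ∨ ∃ h, (⟨v, h⟩ : B) ∈ N := by
    intro v
    simp [cov]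
  have hsum : ∑ u ∈ cov, a u ≤ s.card := by
    refine le_trans ?_ hcard
    have := Finset.sum_union_inter (s₁ := Xᶜ.map (Function.Embedding.subtype _))
      (s₂ := N.map (Function.Embedding.subtype _)) (f := a)
    rw [Finset.sum_map, Finset.sum_map] at this
    exact (Nat.le_add_right _ _).trans this.le
  have hmatch : HasMatching G c s.card a := by
    refine ⟨s.map fun p => (p.1.1, p.2.1), Multiset.card_map _ _, ?_, fun u => ?_⟩
    · intro p hp
      obtain ⟨q, hq, rfl⟩ := Multiset.mem_map.1 hp
      exact ⟨hr q hq, q.1.2.1⟩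
    · rw [edgeExponent_apply, Multiset.map_map, Multiset.map_map]
      have e1 : (s.map (Prod.fst ∘ fun p : A × B => ((p.1.1, p.2.1) : V × V))) =
          (s.map Prod.fst).map Subtype.val := by rw [Multiset.map_map]; rfl
      have e2 : (s.map (Prod.snd ∘ fun p : A × B => ((p.1.1, p.2.1) : V × V))) =
          (s.map Prod.snd).map Subtype.val := by rw [Multiset.map_map]; rfl
      rw [e1, e2]
      by_cases hA : ∃ h : u ∈ c.supp, φ ⟨u, h⟩ ≠ φ ⟨v₀, hv₀⟩
      · have h1 := Multiset.count_map_eq_count' Subtype.val (s.map Prod.fst)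
          Subtype.val_injective (⟨u, hA⟩ : A)
        have h2 : ((s.map Prod.snd).map Subtype.val).count u = 0 := by
          rw [Multiset.count_eq_zero]
          intro h
          obtain ⟨⟨_, hB⟩, -, rfl⟩ := Multiset.mem_map.1 h
          exact hA.2 hB.2
        rw [h2, add_zero]
        exact h1.trans_le (ha _)
      · have h1 : ((s.map Prod.fst).map Subtype.val).count u = 0 := by
          rw [Multiset.count_eq_zero]
          intro h
          obtain ⟨⟨_, hA'⟩, -, rfl⟩ := Multiset.mem_map.1 h
          exact hA hA'
        rw [h1, zero_add]
        by_cases hB : ∃ h : u ∈ c.supp, φ ⟨u, h⟩ = φ ⟨v₀, hv₀⟩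
        · exact (Multiset.count_map_eq_count' Subtype.val (s.map Prod.snd)
            Subtype.val_injective (⟨u, hB⟩ : B)).trans_le (hb _)
        · rw [Multiset.count_eq_zero.2]
          · exact Nat.zero_le _
          · intro h
            obtain ⟨⟨_, hB'⟩, -, rfl⟩ := Multiset.mem_map.1 h
            exact hB hB'
  have hcover : ∀ v w, G.Adj v w → G.connectedComponentMk v = c → v ∈ cov ∨ w ∈ cov := by
    have key : ∀ v w, G.Adj v w → ∀ (hv : v ∈ c.supp) (hw : w ∈ c.supp),
        φ ⟨v, hv⟩ ≠ φ ⟨v₀, hv₀⟩ → φ ⟨w, hw⟩ = φ ⟨v₀, hv₀⟩ → v ∈ cov ∨ w ∈ cov := by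
      intro v w hvw hv hw h1 h2
      by_cases hX : (⟨v, hv, h1⟩ : A) ∈ X
      · exact .inr ((hcov w).2 (.inr ⟨⟨hw, h2⟩, (hN _).2 ⟨_, hX, hvw⟩⟩))
      · exact .inl ((hcov v).2 (.inl ⟨_, hX⟩))
    intro v w hvw hv
    have hw : w ∈ c.supp :=
      (SimpleGraph.ConnectedComponent.connectedComponentMk_eq_of_adj hvw).symm.trans hv
    have hne : φ ⟨v, hv⟩ ≠ φ ⟨w, hw⟩ := φ.valid hvw
    by_cases h1 : φ ⟨v, hv⟩ = φ ⟨v₀, hv₀⟩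
    · exact (key w v hvw.symm hw hv (fun h => hne (h1.trans h.symm)) h1).symm
    · refine key v w hvw hv hw h1 ?_
      revert h1 hne
      generalize φ ⟨v, hv⟩ = x
      generalize φ ⟨w, hw⟩ = y
      generalize φ ⟨v₀, hv₀⟩ = z
      intro h1 h2
      omega
  obtain ⟨v, hvc, hv⟩ : ∃ v, G.connectedComponentMk v = c ∧ v ∉ cov := by
    rcases X.eq_empty_or_nonempty with rfl | ⟨x, hx⟩
    · refine ⟨v₀, hv₀, fun h => ?_⟩
      rcases (hcov v₀).1 h with ⟨h, -⟩ | ⟨h, h'⟩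
      · exact h.2 rfl
      · simpa using (hN _).1 h'
    · refine ⟨x.1, x.2.1, fun h => ?_⟩
      rcases (hcov x.1).1 h with ⟨h, h'⟩ | ⟨h, -⟩
      · exact h' hx
      · exact x.2.2 h.2
  refine ⟨v, hvc, fun a' j ha' hj => hmatch.of_le ?_⟩
  obtain ⟨t, rfl, ht, hta⟩ := hj
  -- Weak duality: every edge meets the cover, so the weight of the cover bounds any matching. That
  -- weight ignores the exponent of the uncovered `v`.
  have h1 : ∀ t : Multiset (V × V), (∀ p ∈ t, p.1 ∈ cov ∨ p.2 ∈ cov) →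
      t.card ≤ ∑ u ∈ cov, edgeExponent t u := by
    intro t ht
    induction t using Multiset.induction with
    | empty => simp
    | cons p t ih =>
      have h2 := ih fun q hq => ht q (Multiset.mem_cons_of_mem hq)
      have h3 := ht p (Multiset.mem_cons_self _ _)
      simp only [edgeExponent_cons, Finsupp.add_apply, Finsupp.single_apply, Multiset.card_cons,
        Finset.sum_add_distrib, Finset.sum_ite_eq]
      split_ifs <;> first | omega | tauto
  calc t.card ≤ ∑ u ∈ cov, edgeExponent t u := h1 t fun p hp => hcover _ _ (ht p hp).1 (ht p hp).2
    _ ≤ ∑ u ∈ cov, a u := Finset.sum_le_sum fun u hu =>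
      (hta u).trans (ha' u fun h => hv (h ▸ hu))
    _ ≤ s.card := hsum

open Classical in
/-- The largest `j ≤ k` for which the component `c` has `j` edges whose product divides `x^a`. -/
def matchingNumber {V : Type*} (G : SimpleGraph V) (k : ℕ) (c : G.ConnectedComponent)
    (a : V → ℕ) : ℕ :=
  Nat.findGreatest (fun j => HasMatching G c j a) k

theorem hasMatching_matchingNumber {V : Type*} (G : SimpleGraph V) (k : ℕ)
    (c : G.ConnectedComponent) (a : V → ℕ) : HasMatching G c (matchingNumber G k c a) a := by
  classical
  exact Nat.findGreatest_spec (P := fun j => HasMatching G c j a) (Nat.zero_le k) (.zero G c a)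

theorem matchingNumber_le {V : Type*} (G : SimpleGraph V) (k : ℕ) (c : G.ConnectedComponent)
    (a : V → ℕ) : matchingNumber G k c a ≤ k :=
  open Classical in Nat.findGreatest_le k

theorem HasMatching.le_matchingNumber {V : Type*} {G : SimpleGraph V} {c : G.ConnectedComponent}
    {j k : ℕ} {a : V → ℕ} (h : HasMatching G c j a) (hj : j ≤ k) : j ≤ matchingNumber G k c a := by
  classical
  exact Nat.le_findGreatest hj h

theorem matchingNumber_mono {V : Type*} {G : SimpleGraph V} {k : ℕ} {c : G.ConnectedComponent}
    {a b : V → ℕ} (hab : ∀ u, G.connectedComponentMk u = c → min (a u) k ≤ b u) :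
    matchingNumber G k c a ≤ matchingNumber G k c b :=
  ((hasMatching_matchingNumber G k c a).mono (matchingNumber_le ..) hab).le_matchingNumber
    (matchingNumber_le ..)

/-- Edges sort by component, and conversely matchings of different components have disjoint
supports, so their union still divides `x^m`; excess edges are discarded. -/
theorem exists_edges_iff_le_sum_matchingNumber {V : Type*} (G : SimpleGraph V)
    [Fintype G.ConnectedComponent] (k : ℕ) (m : V →₀ ℕ) :
    (∃ s : Multiset (V × V), s.card = k ∧ (∀ p ∈ s, G.Adj p.1 p.2) ∧ edgeExponent s ≤ m) ↔
      k ≤ ∑ c, matchingNumber G k c m := by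
  classical
  constructor
  · rintro ⟨s, hs, hadj, hm⟩
    have h1 := Multiset.sum_count_eq_card (s := Finset.univ)
      (m := s.map fun p => G.connectedComponentMk p.1) (fun _ _ => Finset.mem_univ _)
    rw [Multiset.card_map, hs] at h1
    refine h1.symm.trans_le (Finset.sum_le_sum fun c _ => ?_)
    rw [Multiset.count_map]
    refine HasMatching.le_matchingNumber ⟨_, rfl, fun p hp => ?_, fun u => ?_⟩ ?_
    · rw [Multiset.mem_filter] at hp
      exact ⟨hadj p hp.1, hp.2.symm⟩
    · exact (edgeExponent_mono (Multiset.filter_le _ _) u).trans (hm u)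
    · exact (Multiset.card_le_card (Multiset.filter_le _ _)).trans hs.le
  · intro h
    choose s hs1 hs2 hs3 using fun c => hasMatching_matchingNumber G k c m
    obtain ⟨t, ht, htk⟩ := (∑ c, s c).exists_le_card_eq (n := k) (by
      rw [Multiset.card_sum]; simpa only [hs1] using h)
    refine ⟨t, htk, fun p hp => ?_, (edgeExponent_mono ht).trans fun u => ?_⟩
    · obtain ⟨c, -, hc⟩ := Multiset.mem_sum.1 (Multiset.mem_of_le ht hp)
      exact (hs2 c p hc).1
    · rw [edgeExponent_sum, Finsupp.finsetSum_apply,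
        Finset.sum_eq_single (G.connectedComponentMk u)]
      · exact hs3 _ u
      · exact fun c _ hc => edgeExponent_apply_eq_zero (hs2 c) hc.symm
      · exact fun h => absurd (Finset.mem_univ _) h

/-- The members of a nonempty type can be selected from its nonempty subsets so that the choice
survives in each smaller subset which contains it. -/
theorem exists_stable_choice (V : Type*) [Nonempty V] : ∃ pick : Set V → V,
    (∀ S : Set V, S.Nonempty → pick S ∈ S) ∧ ∀ S S' : Set V, S' ⊆ S → pick S ∈ S' →
      pick S' = pick S := by
  classical
  -- The choice is the least element for some well-order.
  obtain ⟨_, _⟩ := exists_wellFoundedLT V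
  refine ⟨fun S => if h : S.Nonempty then wellFounded_lt.min S h else Classical.arbitrary V, ?_, ?_⟩
  · intro S h
    simp only [h, dif_pos]
    exact WellFounded.min_mem _ _ _
  · intro S S' hS h
    have h' : S'.Nonempty := ⟨_, h⟩
    have hS' : S.Nonempty := h'.mono hS
    simp only [h', hS', dif_pos] at h ⊢
    exact WellFounded.min_eq_of_forall_not_lt _ h fun x hx => WellFounded.not_lt_min _ _ (hS hx)

end

/-! ### The bound on the Stanley depth -/

theorem theorem2p3 {V : Type*} [Finite V] {K : Type*} [Field K] (G : SimpleGraph V)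
    (k : ℕ) (hk : 1 ≤ k) :
    (numBipartiteComponents G : WithBot ℕ∞) ≤ stanleyDepth (quotientGrading (edgeIdeal K G ^ k)) := by
  classical
  have := Fintype.ofFinite V
  have := Fintype.ofFinite G.ConnectedComponent
  have hV : ∀ c : G.ConnectedComponent, Nonempty V := fun c => ⟨c.nonempty_supp.some⟩
  choose pick hpick hstab using fun c : G.ConnectedComponent =>
    @exists_stable_choice V (hV c)
  let F := matchingNumber G k
  -- Testing the value `k` suffices: `F` does not distinguish it from any larger exponent.
  let free : G.ConnectedComponent → (V → ℕ) → Set V := fun c a =>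
    {v | G.connectedComponentMk v = c ∧ F c (Function.update a v k) ≤ F c a}
  let P : Finset G.ConnectedComponent := {c | c.toSimpleGraph.IsBipartite}
  have hF : ∀ c a b, (∀ u, G.connectedComponentMk u = c → min (a u) k = min (b u) k) →
      F c a = F c b := fun c a b h => le_antisymm
    (matchingNumber_mono fun u hu => (h u hu).trans_le (min_le_left _ _))
    (matchingNumber_mono fun u hu => (h u hu).symm.trans_le (min_le_left _ _))
  have hfree : ∀ c ∈ P, ∀ a, (free c a).Nonempty := by
    intro c hc a
    obtain ⟨v, hv, h⟩ := exists_free_vertex (by simpa [P] using hc) a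
    refine ⟨v, hv, (h _ _ (fun u hu => ?_)
      (hasMatching_matchingNumber G k c _)).le_matchingNumber (matchingNumber_le ..)⟩
    rw [Function.update_of_ne hu]
  obtain ⟨T, hTfin, hTcard, hTpart, hTlabel⟩ := exists_exponentCone_partition
    G.connectedComponentMk P k (fun c a => (F c a, pick c (free c a))) (fun _ l => l.2)
    (by
      intro c a b h
      have : free c a = free c b := by
        ext v
        refine and_congr_right fun _ => ?_
        rw [hF c a b h, hF c (Function.update a v k) (Function.update b v k) fun u hu => ?_]
        rcases eq_or_ne u v with rfl | huv
        · simp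
        · simpa [huv] using h u hu
      simp only [this, hF c a b h])
    (fun c hc a => (hpick c _ (hfree c hc a)).1)
    (by
      intro c hc a t ht
      have hmem := hpick c _ (hfree c hc a)
      simp only at ht ⊢
      generalize hv : pick c (free c a) = v at *
      have hle : a ≤ Function.update a v t := by
        intro u
        rcases eq_or_ne u v with rfl | huv
        · simpa using ht
        · simp [huv]
      have hFeq : F c (Function.update a v t) = F c a := by
        refine le_antisymm (le_trans (matchingNumber_mono fun u _ => ?_) hmem.2)
          (matchingNumber_mono fun u _ => (min_le_left _ _).trans (hle u))
        rcases eq_or_ne u v with rfl | huv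
        · simp
        · simp [huv]
      rw [hFeq]
      congr 1
      rw [← hv]
      -- With `F c` unchanged, growth of the exponents can only shrink the free set, and `v` itself
      -- remains free; so the pick is unchanged.
      refine hstab c _ _ ?_ ?_
      · rintro w ⟨hw, hw'⟩
        rw [hv, hFeq] at hw'
        refine ⟨hw, le_trans (matchingNumber_mono fun u _ => (min_le_left _ _).trans ?_) hw'⟩
        rcases eq_or_ne u w with rfl | huw
        · simp
        · simpa [huw] using hle u
      · rw [hv]
        refine ⟨hmem.1, ?_⟩
        rw [Function.update_idem, hFeq]
        exact hmem.2)
  have hPcard : P.card = numBipartiteComponents G := by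
    rw [numBipartiteComponents, Nat.card_eq_fintype_card, Fintype.card_subtype]
  let X : Set (V →₀ ℕ) := {m | ∑ c, F c m < k}
  let ι := {i : (V → ℕ) × Finset V // i ∈ T ∧ ∑ c, F c i.1 < k}
  have : Finite ι := (hTfin.subset fun _ h => h.1 : {i | i ∈ T ∧ ∑ c, F c i.1 < k}.Finite)
  have hsum : ∀ i ∈ T, ∀ a ∈ exponentCone i.1 i.2, ∑ c, F c a = ∑ c, F c i.1 := fun i hi a ha =>
    Finset.sum_congr rfl fun c _ => congrArg Prod.fst (hTlabel i hi a ha c)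
  refine le_stanleyDepth_of_cones (X := X) ?_ (ι := ι)
    (fun i => Finsupp.equivFunOnFinite.symm i.1.1) (fun i => i.1.2) _ ?_ ?_ ?_
  · intro f
    rw [mem_edgeIdeal_pow]
    refine forall₂_congr fun m _ => ?_
    rw [exists_edges_iff_le_sum_matchingNumber]
    exact not_lt.symm
  · intro i
    rw [← hPcard]
    exact hTcard _ i.2.1
  · intro i a ha
    exact (hsum _ i.2.1 a ha).trans_lt i.2.2
  · intro a ha
    obtain ⟨i, ⟨hi, hai⟩, huniq⟩ := hTpart a
    refine ⟨⟨i, hi, (hsum i hi a hai).symm.trans_lt ha⟩, hai, fun j hj => ?_⟩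
    exact Subtype.ext (huniq j.1 ⟨j.2.1, hj⟩)
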